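/- Let $G=(X\,\dot\cup\,Y,E)$ be a finite bipartite graph, with every edge joining a vertex of $X$ to a vertex of $Y$, and let $r\ge 1$ be an integer. An $r$-star matching in $G$ is a set of pairwise vertex-disjoint copies of the star $K_{1,r}$ in $G$, each with its center in $X$ and its $r$ leaves in $Y$; its size is the number of its stars. It is envy-free if no vertex of $X$ that is not the center of one of its stars is adjacent to a leaf of one of its stars. Let $N_G(X)$ be the set of vertices of $Y$ adjacent to some vertex of $X$. (a) There is a polynomial-time algorithm that, given $r$ and $G$, finds an envy-free $r$-star matching in $G$ of maximum size among all envy-free $r$-star matchings in $G$. Its number of steps (on a random access machine with addition and subtraction at unit cost) is bounded by a fixed polynomial in $|X|+|Y|$, the same for all $r$. (b) If $|N_G(X)|\ge r|X|\ge 1$, then $G$ contains a nonempty envy-free $r$-star matching. -/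

import Mathlib

/-! ## Envy-free star matchings

A bipartite graph with parts `X` and `Y` is given by its edge relation `Adj : X → Y → Prop`.
A copy of the star `K_{1,r}` with center in `X` and leaves in `Y` is given by the pair
`S = (S.1, S.2)` of its center and its set of leaves. -/

namespace StarMatching

/-- The neighborhood of a set `A` of vertices in `X`. -/
def neighborhood {X Y : Type*} (Adj : X → Y → Prop) (A : Set X) : Set Y :=
  {y | ∃ x ∈ A, Adj x y}

/-- `S` is a copy of `K_{1,r}` in the graph, with center in `X` and leaves in `Y`. -/
structure IsStar {X Y : Type*} (Adj : X → Y → Prop) (r : ℕ) (S : X × Finset Y) : Prop where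
  card_leaves : S.2.card = r
  adj : ∀ y ∈ S.2, Adj S.1 y

/-- An `r`-star matching: a set of pairwise vertex-disjoint copies of `K_{1,r}`. -/
structure IsStarMatching {X Y : Type*} (Adj : X → Y → Prop) (r : ℕ)
    (W : Finset (X × Finset Y)) : Prop where
  isStar : ∀ S ∈ W, IsStar Adj r S
  disjoint : ∀ S ∈ W, ∀ T ∈ W, S ≠ T → S.1 ≠ T.1 ∧ Disjoint S.2 T.2

/-- An `r`-star matching is envy-free if no vertex of `X` that is not the center of one of its
stars is adjacent to a leaf of one of its stars. -/
structure IsEnvyFreeStarMatching {X Y : Type*} (Adj : X → Y → Prop) (r : ℕ)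
    (W : Finset (X × Finset Y)) : Prop extends IsStarMatching Adj r W where
  envyFree : ∀ x : X, (∀ S ∈ W, S.1 ≠ x) → ∀ S ∈ W, ∀ y ∈ S.2, ¬ Adj x y

/-- An envy-free `r`-star matching with the largest possible number of stars. -/
structure IsMaximumEnvyFreeStarMatching {X Y : Type*} (Adj : X → Y → Prop) (r : ℕ)
    (W : Finset (X × Finset Y)) : Prop extends IsEnvyFreeStarMatching Adj r W where
  maximum : ∀ W' : Finset (X × Finset Y), IsEnvyFreeStarMatching Adj r W' → W'.card ≤ W.card

end StarMatching

/-! ## Random access machine programs with running time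

Structured programs for a random access machine whose memory consists of registers and arrays
of natural numbers. Arithmetic is restricted to addition and truncated subtraction (there is no
multiplication), so that polynomial time with unit costs is polynomial time on a Turing machine.
A program is a finite object and mentions finitely many registers and arrays. -/

namespace RAM

/-- Expressions. -/
inductive Expr : Type
  /-- a constant -/
  | const (c : ℕ)
  /-- the content of register `x` -/
  | reg (x : ℕ)
  /-- the cell of array `a` at the index that is the value of `i` -/
  | arr (a : ℕ) (i : Expr)
  /-- sum -/
  | add (e f : Expr)
  /-- truncated difference -/
  | sub (e f : Expr)

/-- Memory contents: `reg x` is the content of register `x`, and `arr a i` is that of the cell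
with index `i` in array `a`. -/
@[ext]
structure Memory : Type where
  reg : ℕ → ℕ
  arr : ℕ → ℕ → ℕ

/-- The value of an expression. -/
def Expr.eval (m : Memory) : Expr → ℕ
  | .const c => c
  | .reg x => m.reg x
  | .arr a i => m.arr a (i.eval m)
  | .add e f => e.eval m + f.eval m
  | .sub e f => e.eval m - f.eval m

/-- The time it takes to evaluate an expression: the number of its constants, memory accesses
and arithmetic operations. -/
def Expr.cost : Expr → ℕ
  | .const _ => 1
  | .reg _ => 1
  | .arr _ i => i.cost + 1
  | .add e f => e.cost + f.cost + 1
  | .sub e f => e.cost + f.cost + 1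

/-- Write `v` into register `x`. -/
def Memory.setReg (m : Memory) (x v : ℕ) : Memory :=
  { m with reg := Function.update m.reg x v }

/-- Write `v` into the cell of array `a` with index `i`. -/
def Memory.setArr (m : Memory) (a i v : ℕ) : Memory :=
  { m with arr := Function.update m.arr a (Function.update (m.arr a) i v) }

/-- Programs. In tests, a value counts as true if it is nonzero. -/
inductive Prog : Type
  /-- do nothing -/
  | skip
  /-- write the value of `e` into register `x` -/
  | setReg (x : ℕ) (e : Expr)
  /-- write the value of `e` into the cell of array `a` at the index that is the value of `i` -/
  | setArr (a : ℕ) (i e : Expr)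
  /-- first `p`, then `q` -/
  | seq (p q : Prog)
  /-- if `e` then `p` else `q` -/
  | ite (e : Expr) (p q : Prog)
  /-- while `e` do `p` -/
  | loop (e : Expr) (p : Prog)

/-- `Exec p m t m'`: the program `p`, started with memory contents `m`, halts after exactly `t`
steps with memory contents `m'`. -/
inductive Exec : Prog → Memory → ℕ → Memory → Prop
  | skip (m : Memory) : Exec .skip m 1 m
  | setReg (x : ℕ) (e : Expr) (m : Memory) :
      Exec (.setReg x e) m (e.cost + 1) (m.setReg x (e.eval m))
  | setArr (a : ℕ) (i e : Expr) (m : Memory) :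
      Exec (.setArr a i e) m (i.cost + e.cost + 1) (m.setArr a (i.eval m) (e.eval m))
  | seq {p q : Prog} {m m' m'' : Memory} {t t' : ℕ} :
      Exec p m t m' → Exec q m' t' m'' → Exec (.seq p q) m (t + t') m''
  | ite_true {e : Expr} {p q : Prog} {m m' : Memory} {t : ℕ} :
      e.eval m ≠ 0 → Exec p m t m' → Exec (.ite e p q) m (e.cost + 1 + t) m'
  | ite_false {e : Expr} {p q : Prog} {m m' : Memory} {t : ℕ} :
      e.eval m = 0 → Exec q m t m' → Exec (.ite e p q) m (e.cost + 1 + t) m'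
  | loop_done {e : Expr} {p : Prog} {m : Memory} :
      e.eval m = 0 → Exec (.loop e p) m (e.cost + 1) m
  | loop_step {e : Expr} {p : Prog} {m m' m'' : Memory} {t t' : ℕ} :
      e.eval m ≠ 0 → Exec p m t m' → Exec (.loop e p) m' t' m'' →
        Exec (.loop e p) m (e.cost + 1 + t + t') m''

end RAM

namespace StarMatching

/-! ## Input and output of an algorithm for star matchings -/

open Classical in
/-- The initial memory for the number `r` and a bipartite graph with parts `Fin n` and `Fin k`:
registers `0`, `1`, `2` hold `n`, `k`, `r`, array `0` holds the `n × k` adjacency matrix row by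
row, and everything else is zero. -/
noncomputable def input (r n k : ℕ) (Adj : Fin n → Fin k → Prop) : RAM.Memory where
  reg x := if x = 0 then n else if x = 1 then k else if x = 2 then r else 0
  arr a c := if a = 0 ∧ ∃ (i : Fin n) (j : Fin k), c = i * k + j ∧ Adj i j then 1 else 0

/-- Array `1` describes `W`: its `j`-th cell is `i + 1` if `j` is a leaf of a star of `W` with
center `i`, and `0` if `j` is not a leaf of any star of `W`. -/
structure IsOutput {n k : ℕ} (m : RAM.Memory) (W : Finset (Fin n × Finset (Fin k))) : Prop where
  leaf : ∀ S ∈ W, ∀ j ∈ S.2, m.arr 1 j = S.1 + 1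
  not_leaf : ∀ j : Fin k, (∀ S ∈ W, j ∉ S.2) → m.arr 1 j = 0

/-- The program `prog`, given an integer `r ≥ 1` and a bipartite graph with parts of sizes `n`
and `k`, halts within `T (n + k)` steps and outputs a maximum envy-free `r`-star matching. -/
def FindsMaximumEnvyFreeStarMatching (prog : RAM.Prog) (T : ℕ → ℕ) : Prop :=
  ∀ r : ℕ, 1 ≤ r → ∀ (n k : ℕ) (Adj : Fin n → Fin k → Prop),
    ∃ (t : ℕ) (m : RAM.Memory) (W : Finset (Fin n × Finset (Fin k))),
      RAM.Exec prog (input r n k Adj) t m ∧ t ≤ T (n + k) ∧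
      IsOutput m W ∧ IsMaximumEnvyFreeStarMatching Adj r W

end StarMatching

/-!
A maximum envy-free star matching is found by an auction in which the vertices of `X` bid for those
of `Y`. Each `x` has a level and each `y` has a price and possibly an owner, and there is a top
level `B = |X| + 1`. A vertex `x` that owns fewer than `r` vertices takes any neighbor whose price
is below its level, and the price becomes this level; if there is no such neighbor, `x` raises its
level by one. At the top level, `x` does not acquire its neighbors but takes them off the market.
All changes increase the sum of the prices and levels, which is bounded by `B * (|X| + |Y|)`, so the
auction ends after polynomially many steps.

In the end, a vertex `x` either owns exactly `r` vertices or has reached the top level, so that none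
of its neighbors has an owner. Hence the vertices of the first kind, together with what they own,
form an envy-free star matching. It is of maximum size, because a vertex that reaches the top level
is not a center of any envy-free star matching: this is
`StarMatching.Auction.Invariant.not_center_of_load_lt`, a counting argument based on the
invariant that no neighbor of `x` is cheaper by more than one than a vertex owned by `x`.

The program keeps the state of the auction in arrays and scans the adjacency matrix, returning to
its beginning after each change. It is a single loop with a loop-free body, so that its running time
follows from `RAM.Prog.LoopFree.exec_loop` and the decreasing index of `StarMatching.Scanning`.

The existence of a nonempty envy-free star matching follows from Hall's theorem, applied to a
minimal set that satisfies a suitable counting condition.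
-/

namespace StarMatching

open Finset

/-! ### Existence of a nonempty envy-free star matching -/

/-- A set `C` of vertices of `X` that is minimal among the nonempty ones with at least `r * #C`
non-isolated vertices of `Y` whose neighbors all lie in `C` satisfies Hall's condition: if
`A ⊆ C` violated it, `C \ A` would be a smaller such set. -/
theorem exists_nonempty_envyFree {X Y : Type*} [Finite X] [Finite Y] (Adj : X → Y → Prop) (r : ℕ)
    (hcard : r * Nat.card X ≤ (neighborhood Adj Set.univ).ncard) (hpos : 1 ≤ r * Nat.card X) :
    ∃ W : Finset (X × Finset Y), W.Nonempty ∧ IsEnvyFreeStarMatching Adj r W := by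
  classical
  have := Fintype.ofFinite X
  have := Fintype.ofFinite Y
  set own : Finset X → Finset Y :=
    fun C => {y | (∃ x, Adj x y) ∧ ∀ x, Adj x y → x ∈ C} with hown
  have huniv : univ ∈ {C : Finset X | C.Nonempty ∧ r * #C ≤ #(own C)} := by
    constructor
    · rw [← card_pos, card_univ, ← Nat.card_eq_fintype_card]
      exact Nat.pos_of_mul_pos_left hpos
    · have : neighborhood Adj Set.univ = (own univ : Set Y) := by
        ext y; simp [neighborhood, hown]
      rw [this, Set.ncard_coe_finset, Nat.card_eq_fintype_card] at hcard
      simpa using hcard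
  obtain ⟨C, ⟨⟨hCne, hCcard⟩, hCmin⟩⟩ :=
    (Set.toFinite {C : Finset X | C.Nonempty ∧ r * #C ≤ #(own C)}).exists_minimal ⟨_, huniv⟩
  have hall : ∀ A ⊆ C, r * #A ≤ #{y ∈ own C | ∃ x ∈ A, Adj x y} := by
    intro A hA
    by_contra! hlt
    have hsub : own C \ {y ∈ own C | ∃ x ∈ A, Adj x y} ⊆ own (C \ A) := by
      intro y hy
      simp only [hown, mem_sdiff, mem_filter, mem_univ, true_and] at hy ⊢
      exact ⟨hy.1.1, fun x hx => ⟨hy.1.2 x hx, fun hxA => hy.2 ⟨hy.1, x, hxA, hx⟩⟩⟩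
    have h1 := card_le_card hsub
    have h2 := le_card_sdiff {y ∈ own C | ∃ x ∈ A, Adj x y} (own C)
    have h3 : r * #(C \ A) + r * #A = r * #C := by
      rw [← mul_add, card_sdiff_add_card_eq_card hA]
    have hne : (C \ A).Nonempty := by
      obtain ⟨y, hy⟩ := card_pos.1 (show 0 < #(own (C \ A)) by omega)
      simp only [hown, mem_filter, mem_univ, true_and] at hy
      obtain ⟨⟨x, hx⟩, h⟩ := hy
      exact ⟨x, h x hx⟩
    have hle : C ⊆ C \ A := hCmin ⟨hne, by omega⟩ sdiff_subset
    have hA0 : A = ∅ := by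
      rw [eq_empty_iff_forall_notMem]
      exact fun x hx => (mem_sdiff.1 (hle (hA hx))).2 hx
    simp [hA0] at hlt
  obtain ⟨f, hf, hfmem⟩ := (all_card_le_biUnion_card_iff_exists_injective
      (fun p : {x // x ∈ C} × Fin r => {y ∈ own C | Adj p.1 y})).1 (by
    intro s
    have h1 : #s ≤ r * #(s.image fun p => p.1.1) := by
      have := card_le_card_of_injOn (s := s)
        (t := (s.image fun p => p.1.1) ×ˢ (univ : Finset (Fin r))) (fun p => (p.1.1, p.2))
        (fun p hp => by
          simp only [coe_product, Set.mem_prod]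
          exact ⟨mem_image_of_mem _ hp, by simp⟩)
        (fun p _ q _ h => by
          simp only [Prod.mk.injEq] at h
          exact Prod.ext (Subtype.ext h.1) h.2)
      rwa [card_product, card_univ, Fintype.card_fin, mul_comm] at this
    have h2 := hall (s.image fun p => p.1.1) (by
      intro x hx
      obtain ⟨p, -, rfl⟩ := mem_image.1 hx
      exact p.1.2)
    refine h1.trans (h2.trans (card_le_card ?_))
    intro y hy
    obtain ⟨hy1, x, hx, hxy⟩ := mem_filter.1 hy
    obtain ⟨p, hp, rfl⟩ := mem_image.1 hx
    exact mem_biUnion.2 ⟨p, hp, mem_filter.2 ⟨hy1, hxy⟩⟩)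
  simp only [hown, mem_filter, mem_univ, true_and] at hfmem
  refine ⟨C.attach.image fun x => (x.1, univ.image fun i => f (x, i)),
    by simpa using hCne, ⟨⟨?_, ?_⟩, ?_⟩⟩
  · intro S hS
    obtain ⟨x, -, rfl⟩ := mem_image.1 hS
    refine ⟨?_, ?_⟩
    · rw [card_image_of_injective _ fun i j h => (Prod.ext_iff.1 (hf h)).2]
      simp
    · intro y hy
      obtain ⟨i, -, rfl⟩ := mem_image.1 hy
      exact (hfmem (x, i)).2
  · intro S hS T hT hST
    obtain ⟨x, -, rfl⟩ := mem_image.1 hS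
    obtain ⟨z, -, rfl⟩ := mem_image.1 hT
    have hxz : x ≠ z := by rintro rfl; exact hST rfl
    refine ⟨fun h => hxz (Subtype.ext h), disjoint_left.2 fun y hy hy' => ?_⟩
    obtain ⟨i, -, rfl⟩ := mem_image.1 hy
    obtain ⟨j, -, hj⟩ := mem_image.1 hy'
    exact hxz (Prod.ext_iff.1 (hf hj)).1.symm
  · intro x hx S hS y hy hxy
    obtain ⟨z, -, rfl⟩ := mem_image.1 hS
    obtain ⟨i, -, rfl⟩ := mem_image.1 hy
    exact hx _ (mem_image.2 ⟨⟨x, (hfmem (z, i)).1.2 x hxy⟩, mem_attach _ _, rfl⟩) rfl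

/-! ### Star matchings from an auction -/

/-- The state of an auction in which the vertices of `X` bid for those of `Y`. Each `y` has a
price and possibly an owner. The level of `x` is what `x` offers at present. -/
structure Auction (X Y : Type*) where
  owner : Y → Option X
  price : Y → ℕ
  level : X → ℕ

namespace Auction

variable {X Y : Type*}

/-- The number of vertices of `Y` that `x` owns. -/
def load [DecidableEq X] [Fintype Y] (s : Auction X Y) (x : X) : ℕ := #{y | s.owner y = some x}

/-- `x` pays its level for `y`. At the top level `B` it does not acquire `y` but takes it off the
market. -/
def take [DecidableEq Y] (B : ℕ) (s : Auction X Y) (x : X) (y : Y) : Auction X Y where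
  owner := Function.update s.owner y (if s.level x < B then some x else none)
  price := Function.update s.price y (s.level x)
  level := s.level

/-- `x` raises its level by one. -/
def raise [DecidableEq X] (s : Auction X Y) (x : X) : Auction X Y where
  owner := s.owner
  price := s.price
  level := Function.update s.level x (s.level x + 1)

/-- The sum of all prices and levels, which measures the progress of the auction. -/
def potential [Fintype X] [Fintype Y] (s : Auction X Y) : ℕ := ∑ y, s.price y + ∑ x, s.level x

/-- What remains true throughout an auction with top level `B`. -/
structure Invariant [DecidableEq X] [Fintype Y] (Adj : X → Y → Prop) (r B : ℕ)
    (s : Auction X Y) : Prop where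
  owner_adj : ∀ {x y}, s.owner y = some x → Adj x y
  price_le_level : ∀ {x y}, s.owner y = some x → s.price y ≤ s.level x
  level_le_price : ∀ {x y}, Adj x y → s.level x ≤ s.price y + 1
  level_le : ∀ x, s.level x ≤ B
  price_le : ∀ y, s.price y ≤ B
  owned : ∀ {y}, 0 < s.price y → s.price y < B → ∃ x, s.owner y = some x
  unowned : ∀ {y}, s.price y = B → s.owner y = none ∧ ∃ x, Adj x y ∧ s.level x = B
  load_le : ∀ x, s.load x ≤ r
  not_center : ∀ {x}, s.level x = B → ∀ W, IsEnvyFreeStarMatching Adj r W → ∀ S ∈ W, S.1 ≠ x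

/-- A vertex is settled if it owns `r` vertices, or else is at the top level, with all its
neighbors off the market. -/
def Settled [DecidableEq X] [Fintype Y] (Adj : X → Y → Prop) (r B : ℕ)
    (s : Auction X Y) (x : X) : Prop :=
  s.load x < r → s.level x = B ∧ ∀ y, Adj x y → s.level x ≤ s.price y

theorem sum_update_add {ι : Type*} [Fintype ι] [DecidableEq ι] (f : ι → ℕ) (i : ι) (v : ℕ) :
    ∑ j, Function.update f i v j + f i = ∑ j, f j + v := by
  have h : ∑ j ∈ univ.erase i, Function.update f i v j = ∑ j ∈ univ.erase i, f j :=
    sum_congr rfl fun j hj => Function.update_of_ne (ne_of_mem_erase hj) v f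
  rw [← add_sum_erase univ f (mem_univ i),
    ← add_sum_erase univ (Function.update f i v) (mem_univ i), Function.update_self, h]
  omega

theorem potential_take [Fintype X] [Fintype Y] [DecidableEq Y] (B : ℕ) {s : Auction X Y} {x : X}
    {y : Y} (h : s.price y < s.level x) : s.potential < (s.take B x y).potential := by
  have := sum_update_add s.price y (s.level x)
  simp only [potential, take]
  omega

theorem potential_raise [DecidableEq X] [Fintype X] [Fintype Y] (s : Auction X Y) (x : X) :
    (s.raise x).potential = s.potential + 1 := by
  have := sum_update_add s.level x (s.level x + 1)
  simp only [potential, raise]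
  omega

theorem load_take [DecidableEq X] [Fintype Y] [DecidableEq Y] (B : ℕ) (s : Auction X Y)
    (x : X) (y : Y) (z : X) :
    (s.take B x y).load z + (if s.owner y = some z then 1 else 0) =
      s.load z + if s.level x < B ∧ x = z then 1 else 0 := by
  have h := sum_update_add (fun y => if s.owner y = some z then 1 else 0) y
    (if s.level x < B ∧ x = z then 1 else 0)
  simp only [load, card_filter]
  rw [← h]
  congr 1
  refine sum_congr rfl fun y' _ => ?_
  by_cases hy : y' = y
  · subst hy
    by_cases hB : s.level x < B <;> simp [take, hB]
  · simp [take, hy]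

namespace Invariant

variable [DecidableEq X] {Adj : X → Y → Prop} {r B : ℕ} {s : Auction X Y}

theorem potential_le [Fintype X] [Fintype Y] (h : s.Invariant Adj r B) :
    s.potential ≤ B * (Fintype.card X + Fintype.card Y) := by
  have h1 : ∑ y, s.price y ≤ _ := sum_le_card_nsmul univ s.price B fun y _ => h.price_le y
  have h2 : ∑ x, s.level x ≤ _ := sum_le_card_nsmul univ s.level B fun x _ => h.level_le x
  simp only [card_univ, smul_eq_mul] at h1 h2
  rw [potential, mul_add, mul_comm B, mul_comm B]
  omega

theorem initial [Fintype Y] (Adj : X → Y → Prop) (r : ℕ) (hB : 0 < B) :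
    (⟨fun _ => none, fun _ => 0, fun _ => 0⟩ : Auction X Y).Invariant Adj r B where
  owner_adj h := by simp at h
  price_le_level h := by simp at h
  level_le_price _ := by simp
  level_le _ := by simp
  price_le _ := by simp
  owned h := by simp at h
  unowned h := by simp at h; omega
  load_le _ := by simp [load]
  not_center h := by simp at h; omega

theorem take [Fintype Y] [DecidableEq Y] (h : s.Invariant Adj r B) {x : X} {y : Y}
    (hxy : Adj x y) (hload : s.load x < r) (hprice : s.price y < s.level x) :
    (s.take B x y).Invariant Adj r B where
  owner_adj {x' y'} h' := by
    by_cases hy : y' = y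
    · subst hy
      by_cases hB : s.level x < B <;> simp [Auction.take, hB] at h'
      exact h' ▸ hxy
    · exact h.owner_adj (by simpa [Auction.take, hy] using h')
  price_le_level {x' y'} h' := by
    by_cases hy : y' = y
    · subst hy
      by_cases hB : s.level x < B <;> simp [Auction.take, hB] at h' ⊢
      exact h' ▸ le_rfl
    · simpa [Auction.take, hy] using h.price_le_level (by simpa [Auction.take, hy] using h')
  level_le_price {x' y'} h' := by
    have := h.level_le_price h'
    by_cases hy : y' = y
    · subst hy
      simp only [Auction.take, Function.update_self]
      omega
    · simpa [Auction.take, hy] using this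
  level_le := h.level_le
  price_le y' := by
    by_cases hy : y' = y
    · simpa [Auction.take, hy] using h.level_le x
    · simpa [Auction.take, hy] using h.price_le y'
  owned {y'} h1 h2 := by
    by_cases hy : y' = y
    · subst hy
      simp only [Auction.take, Function.update_self] at h2 ⊢
      exact ⟨x, if_pos h2⟩
    · simp only [Auction.take, Function.update_of_ne hy] at h1 h2 ⊢
      exact h.owned h1 h2
  unowned {y'} h1 := by
    by_cases hy : y' = y
    · subst hy
      simp only [Auction.take, Function.update_self] at h1 ⊢
      exact ⟨if_neg h1.not_lt, x, hxy, h1⟩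
    · simp only [Auction.take, Function.update_of_ne hy] at h1 ⊢
      exact h.unowned h1
  load_le z := by
    have h1 := load_take B s x y z
    have h2 := h.load_le z
    by_cases hz : x = z
    · subst hz
      split_ifs at h1 <;> omega
    · simp only [hz, and_false, if_false] at h1
      omega
  not_center := h.not_center

/-- A bidder `x` that owns fewer than `r` vertices although its neighbors all have price at least
`B - 1` is not a center of an envy-free star matching `W`. Otherwise, let `T l` be the set of stars
in `W` all neighbors of whose centers have price at least `l`. For `0 < l`, the leaves of the stars
in `T l` are on the market, since `W` is envy-free, and have positive price, so they have owners,
and these are centers of stars in `T (l - 1)`. All of these own at most `r` vertices, and `x` owns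
fewer, so `T (l - 1)` is larger than `T l`. Then `T 0` has at least `B` elements, which is more than
there are vertices in `X`. -/
theorem not_center_of_load_lt [Fintype X] [Fintype Y] [DecidableEq Y] (h : s.Invariant Adj r B)
    (hB : Fintype.card X < B) {x : X} (hload : s.load x < r)
    (hprice : ∀ y, Adj x y → B ≤ s.price y + 1) (W : Finset (X × Finset Y))
    (hW : IsEnvyFreeStarMatching Adj r W) : ∀ S ∈ W, S.1 ≠ x := by
  classical
  rintro S₀ hS₀ rfl
  set T : ℕ → Finset (X × Finset Y) := fun l => {S ∈ W | ∀ y, Adj S.1 y → l ≤ s.price y} with hT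
  have hinj : Set.InjOn Prod.fst (W : Set (X × Finset Y)) := by
    intro S hS S' hS' hfst
    by_contra hne
    exact (hW.disjoint S hS S' hS' hne).1 hfst
  have hmem : ∀ l < B, S₀ ∈ T l := fun l hl =>
    mem_filter.2 ⟨hS₀, fun y hy => by have := hprice y hy; omega⟩
  have hstep : ∀ l, l + 1 < B → #(T (l + 1)) < #(T l) := by
    intro l hl
    have h1 : #((T (l + 1)).biUnion Prod.snd) = r * #(T (l + 1)) := by
      rw [card_biUnion, sum_congr rfl fun S hS =>
        (hW.isStar S (mem_filter.1 hS).1).card_leaves, sum_const, smul_eq_mul, mul_comm]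
      intro S hS S' hS' hne
      exact (hW.disjoint S (mem_filter.1 hS).1 S' (mem_filter.1 hS').1 hne).2
    have h2 : (T (l + 1)).biUnion Prod.snd ⊆
        (T l).biUnion fun S => {y | s.owner y = some S.1} := by
      intro y hy
      obtain ⟨S, hS, hyS⟩ := mem_biUnion.1 hy
      obtain ⟨hSW, hSp⟩ := mem_filter.1 hS
      have hcenter : ∀ z, Adj z y → ∃ S' ∈ W, S'.1 = z := by
        intro z hz
        by_contra! hne
        exact hW.envyFree z hne S hSW y hyS hz
      have hp := hSp y ((hW.isStar S hSW).adj y hyS)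
      have hlt : s.price y < B := by
        refine lt_of_le_of_ne (h.price_le y) fun heq => ?_
        obtain ⟨-, z, hz, hzB⟩ := h.unowned heq
        obtain ⟨S', hS', hfst⟩ := hcenter z hz
        exact h.not_center hzB W hW S' hS' hfst
      obtain ⟨z, hz⟩ := h.owned (by omega) hlt
      obtain ⟨S', hS', rfl⟩ := hcenter z (h.owner_adj hz)
      refine mem_biUnion.2 ⟨S', mem_filter.2 ⟨hS', fun y' hy' => ?_⟩, by simpa using hz⟩
      have := h.price_le_level hz
      have := h.level_le_price hy'
      omega
    have h3 : #((T l).biUnion fun S => {y | s.owner y = some S.1}) < ∑ S ∈ T l, r :=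
      card_biUnion_le.trans_lt
        (sum_lt_sum (fun S _ => h.load_le S.1) ⟨S₀, hmem l (by omega), hload⟩)
    have h4 := card_le_card h2
    rw [sum_const, smul_eq_mul, mul_comm] at h3
    exact lt_of_mul_lt_mul_left (by omega) (Nat.zero_le r)
  -- `x` is the center of a star in `T (B - 1)`, and the sets grow as the index decreases.
  have hcard : ∀ i < B, i + 1 ≤ #(T (B - 1 - i)) := by
    intro i hi
    induction i with
    | zero => exact card_pos.2 ⟨S₀, hmem _ (by omega)⟩
    | succ i ih =>
      have h1 := ih (by omega)
      have h2 := hstep (B - 1 - (i + 1)) (by omega)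
      rw [show B - 1 - (i + 1) + 1 = B - 1 - i by omega] at h2
      omega
  have h1 := hcard (B - 1) (by omega)
  have h2 : #(T (B - 1 - (B - 1))) ≤ #W := card_filter_le _ _
  have h3 := card_le_card_of_injOn (t := (univ : Finset X)) Prod.fst (fun _ _ => by simp) hinj
  rw [card_univ] at h3
  omega

theorem raise [Fintype X] [Fintype Y] [DecidableEq Y] (h : s.Invariant Adj r B)
    (hB : Fintype.card X < B) {x : X} (hload : s.load x < r) (hlevel : s.level x < B)
    (hprice : ∀ y, Adj x y → s.level x ≤ s.price y) : (s.raise x).Invariant Adj r B where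
  owner_adj := h.owner_adj
  price_le_level {x' y'} h' := by
    have := h.price_le_level (y := y') h'
    by_cases hx : x' = x
    · subst hx
      simp only [Auction.raise, Function.update_self]
      omega
    · simpa [Auction.raise, hx] using this
  level_le_price {x' y'} h' := by
    by_cases hx : x' = x
    · subst hx
      simpa [Auction.raise] using hprice y' h'
    · simpa [Auction.raise, hx] using h.level_le_price h'
  level_le x' := by
    by_cases hx : x' = x
    · simpa [Auction.raise, hx] using hlevel
    · simpa [Auction.raise, hx] using h.level_le x'
  price_le := h.price_le
  owned := h.owned
  unowned {y'} h' := by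
    obtain ⟨h1, z, hz, hzB⟩ := h.unowned h'
    have hzx : z ≠ x := by rintro rfl; omega
    exact ⟨h1, z, hz, by simpa [Auction.raise, hzx] using hzB⟩
  load_le := h.load_le
  not_center {x'} h' := by
    by_cases hx : x' = x
    · subst hx
      simp only [Auction.raise, Function.update_self] at h'
      exact h.not_center_of_load_lt hB hload fun y hy => by have := hprice y hy; omega
    · exact h.not_center (by simpa [Auction.raise, hx] using h')

end Invariant

/-- The stars formed by the vertices that own `r` vertices, together with these. -/
def matching [DecidableEq X] [Fintype X] [Fintype Y] (r : ℕ) (s : Auction X Y) :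
    Finset (X × Finset Y) :=
  ({x | s.load x = r} : Finset X).map
    ⟨fun x => (x, ({y | s.owner y = some x} : Finset Y)), fun _ _ h => congrArg Prod.fst h⟩

theorem mem_matching [DecidableEq X] [Fintype X] [Fintype Y] {r : ℕ} {s : Auction X Y}
    {S : X × Finset Y} :
    S ∈ s.matching r ↔ s.load S.1 = r ∧ S.2 = ({y | s.owner y = some S.1} : Finset Y) := by
  simp only [matching, mem_map, mem_filter, mem_univ, true_and]
  constructor
  · rintro ⟨x, hx, rfl⟩
    exact ⟨hx, rfl⟩
  · rintro ⟨h1, h2⟩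
    exact ⟨S.1, h1, Prod.ext rfl h2.symm⟩

theorem Invariant.owner_eq_none [DecidableEq X] [Fintype Y] {Adj : X → Y → Prop} {r B : ℕ}
    {s : Auction X Y} (h : s.Invariant Adj r B) {x : X} (hx : s.Settled Adj r B x)
    (hload : s.load x ≠ r) {y : Y}
    (hy : Adj x y) : s.owner y = none := by
  obtain ⟨h1, h2⟩ := hx (lt_of_le_of_ne (h.load_le x) hload)
  exact (h.unowned (le_antisymm (h.price_le y) (h1 ▸ h2 y hy))).1

/-- When all vertices are settled, a vertex that is not the center of a star is at the top level, so
that its neighbors have no owners and it is not a center of any envy-free star matching. -/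
theorem Invariant.isMaximum [DecidableEq X] [Fintype X] [Fintype Y] {Adj : X → Y → Prop} {r B : ℕ}
    {s : Auction X Y} (h : s.Invariant Adj r B) (hs : ∀ x, s.Settled Adj r B x) :
    IsMaximumEnvyFreeStarMatching Adj r (s.matching r) where
  isStar S hS := by
    obtain ⟨h1, h2⟩ := mem_matching.1 hS
    refine ⟨h2 ▸ h1, fun y hy => h.owner_adj ?_⟩
    simpa [h2] using hy
  disjoint S hS S' hS' hne := by
    obtain ⟨-, h2⟩ := mem_matching.1 hS
    obtain ⟨-, h2'⟩ := mem_matching.1 hS'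
    have hfst : S.1 ≠ S'.1 := fun heq => hne (Prod.ext heq (by rw [h2, h2', heq]))
    refine ⟨hfst, disjoint_left.2 fun y hy hy' => hfst ?_⟩
    simp only [h2, h2', mem_filter, mem_univ, true_and] at hy hy'
    exact Option.some_injective _ (hy.symm.trans hy')
  envyFree x hx S hS y hy hxy := by
    obtain ⟨-, h2⟩ := mem_matching.1 hS
    have hnone := h.owner_eq_none (hs x) (fun hload =>
      hx (x, ({y | s.owner y = some x} : Finset Y)) (mem_matching.2 ⟨hload, rfl⟩) rfl) hxy
    simp [h2, hnone] at hy
  maximum W hW := by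
    rw [matching, card_map]
    refine card_le_card_of_injOn Prod.fst (fun S hS => ?_) fun S hS S' hS' heq => ?_
    · simp only [coe_filter, mem_univ, true_and, Set.mem_ofPred_eq]
      by_contra hne
      exact h.not_center (hs S.1 (lt_of_le_of_ne (h.load_le _) hne)).1 W hW S hS rfl
    · by_contra hne
      exact (hW.disjoint S hS S' hS' hne).1 heq

end Auction

end StarMatching

/-! ### Running time of random access machine programs -/

namespace RAM

/-- An expression that is nonzero if and only if both `e` and `f` are. -/
def Expr.conj (e f : Expr) : Expr :=
  .sub (.add (.sub (.const 1) (.sub (.const 1) e)) (.sub (.const 1) (.sub (.const 1) f))) (.const 1)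

theorem Expr.eval_conj_ne_zero (e f : Expr) (m : Memory) :
    (Expr.conj e f).eval m ≠ 0 ↔ e.eval m ≠ 0 ∧ f.eval m ≠ 0 := by
  simp only [conj, eval]
  omega

theorem Memory.setArr_arr (m : Memory) (a i v b c : ℕ) :
    (m.setArr a i v).arr b c = if b = a ∧ c = i then v else m.arr b c := by
  by_cases hb : b = a
  · subst hb
    by_cases hc : c = i <;> simp [setArr, hc]
  · simp [setArr, hb]

theorem Memory.setArr_reg (m : Memory) (a i v : ℕ) : (m.setArr a i v).reg = m.reg := rfl

namespace Prog

/-- The program contains no loops. -/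
def LoopFree : Prog → Prop
  | .skip => True
  | .setReg _ _ => True
  | .setArr _ _ _ => True
  | .seq p q => p.LoopFree ∧ q.LoopFree
  | .ite _ p q => p.LoopFree ∧ q.LoopFree
  | .loop _ _ => False

/-- The effect of a loop-free program on the memory. -/
def run : Prog → Memory → Memory
  | .skip, m => m
  | .setReg x e, m => m.setReg x (e.eval m)
  | .setArr a i e, m => m.setArr a (i.eval m) (e.eval m)
  | .seq p q, m => q.run (p.run m)
  | .ite e p q, m => if e.eval m = 0 then q.run m else p.run m
  | .loop _ _, m => m

theorem run_setArr (a : ℕ) (i e : Expr) (m : Memory) :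
    (Prog.setArr a i e).run m = m.setArr a (i.eval m) (e.eval m) := rfl

theorem run_seq (p q : Prog) (m : Memory) : (Prog.seq p q).run m = q.run (p.run m) := rfl

theorem run_ite_of_ne_zero {e : Expr} {m : Memory} (p q : Prog) (h : e.eval m ≠ 0) :
    (Prog.ite e p q).run m = p.run m := if_neg h

theorem run_ite_of_eq_zero {e : Expr} {m : Memory} (p q : Prog) (h : e.eval m = 0) :
    (Prog.ite e p q).run m = q.run m := if_pos h

/-- A bound on the number of steps of a loop-free program. -/
def maxCost : Prog → ℕ
  | .skip => 1
  | .setReg _ e => e.cost + 1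
  | .setArr _ i e => i.cost + e.cost + 1
  | .seq p q => p.maxCost + q.maxCost
  | .ite e p q => e.cost + 1 + (p.maxCost + q.maxCost)
  | .loop _ _ => 0

theorem LoopFree.exec_run {p : Prog} (hp : p.LoopFree) (m : Memory) :
    ∃ t ≤ p.maxCost, Exec p m t (p.run m) := by
  induction p generalizing m with
  | skip => exact ⟨_, le_rfl, .skip m⟩
  | setReg x e => exact ⟨_, le_rfl, .setReg x e m⟩
  | setArr a i e => exact ⟨_, le_rfl, .setArr a i e m⟩
  | seq p q ihp ihq =>
    obtain ⟨t, ht, h⟩ := ihp hp.1 m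
    obtain ⟨t', ht', h'⟩ := ihq hp.2 (p.run m)
    exact ⟨t + t', Nat.add_le_add ht ht', .seq h h'⟩
  | ite e p q ihp ihq =>
    by_cases he : e.eval m = 0
    · obtain ⟨t, ht, h⟩ := ihq hp.2 m
      refine ⟨e.cost + 1 + t, by simp only [maxCost]; omega, ?_⟩
      simpa [run, he] using Exec.ite_false he h
    · obtain ⟨t, ht, h⟩ := ihp hp.1 m
      refine ⟨e.cost + 1 + t, by simp only [maxCost]; omega, ?_⟩
      simpa [run, he] using Exec.ite_true he h
  | loop e p => exact hp.elim

/-- A loop halts in time if each run of its body decreases the index `v` of an invariant. -/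
theorem LoopFree.exec_loop {p : Prog} (hp : p.LoopFree) (e : Expr) (inv : ℕ → Memory → Prop)
    (hstep : ∀ v m, inv v m → e.eval m ≠ 0 → ∃ v' < v, inv v' (p.run m)) (v : ℕ) (m : Memory)
    (hm : inv v m) :
    ∃ t m', Exec (.loop e p) m t m' ∧ t ≤ (v + 1) * (e.cost + 1 + p.maxCost) ∧
      (∃ v', inv v' m') ∧ e.eval m' = 0 := by
  induction v using Nat.strong_induction_on generalizing m with
  | _ v ih =>
    by_cases he : e.eval m = 0
    · refine ⟨_, m, .loop_done he, ?_, ⟨v, hm⟩, he⟩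
      nlinarith [Nat.zero_le (v * (e.cost + 1 + p.maxCost))]
    · obtain ⟨v', hv', hinv⟩ := hstep v m hm he
      obtain ⟨t, ht, hexec⟩ := hp.exec_run m
      obtain ⟨t', m', hexec', ht', h⟩ := ih v' hv' _ hinv
      refine ⟨_, m', .loop_step he hexec hexec', ?_, h⟩
      have := Nat.mul_le_mul_right (e.cost + 1 + p.maxCost) hv'
      rw [add_mul, one_mul]
      rw [Nat.succ_eq_add_one] at this
      omega

end Prog

end RAM

namespace StarMatching

/-! ### The auction on a random access machine -/

open RAM

/-- Go back to the beginning of the adjacency matrix. Registers `3` and `4` hold the row and the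
column under inspection, and register `5` the index of this entry in array `0`. -/
def restartProg : Prog :=
  .seq (.setReg 3 (.const 0)) (.seq (.setReg 4 (.const 0)) (.setReg 5 (.const 0)))

/-- `Auction.take` for the current row and column. Array `1` holds the owners, increased by one,
with `0` for no owner; array `2` the prices; array `3` the levels; and array `4`, shifted by one,
the loads. -/
def takeProg : Prog :=
  .seq (.setArr 4 (.arr 1 (.reg 4)) (.sub (.arr 4 (.arr 1 (.reg 4))) (.const 1)))
    (.seq (.setArr 2 (.reg 4) (.arr 3 (.reg 3)))
      (.ite (.sub (.add (.reg 0) (.const 1)) (.arr 3 (.reg 3)))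
        (.seq (.setArr 1 (.reg 4) (.add (.reg 3) (.const 1)))
          (.setArr 4 (.add (.reg 3) (.const 1))
            (.add (.arr 4 (.add (.reg 3) (.const 1))) (.const 1))))
        (.setArr 1 (.reg 4) (.const 0))))

/-- The load of the current row is less than `r`. -/
def deficientExpr : Expr := .sub (.reg 2) (.arr 4 (.add (.reg 3) (.const 1)))

/-- Inspect the current entry, or treat the end of the row. -/
def auctionBody : Prog :=
  .ite (.sub (.reg 1) (.reg 4))
    (.ite (.conj (.arr 0 (.reg 5)) (.conj deficientExpr (.sub (.arr 3 (.reg 3)) (.arr 2 (.reg 4)))))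
      (.seq takeProg restartProg)
      (.seq (.setReg 4 (.add (.reg 4) (.const 1))) (.setReg 5 (.add (.reg 5) (.const 1)))))
    (.ite (.conj deficientExpr (.sub (.add (.reg 0) (.const 1)) (.arr 3 (.reg 3))))
      (.seq (.setArr 3 (.reg 3) (.add (.arr 3 (.reg 3)) (.const 1))) restartProg)
      (.seq (.setReg 3 (.add (.reg 3) (.const 1))) (.setReg 4 (.const 0))))

/-- The entries of the adjacency matrix are inspected one after the other, starting anew after each
change of the state, until the whole matrix has been passed without a change. -/
def auctionProg : Prog := .loop (.sub (.reg 0) (.reg 3)) auctionBody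

/-- The representation of an owner in the memory. -/
def ownerCode {n : ℕ} : Option (Fin n) → ℕ
  | none => 0
  | some i => i + 1

theorem ownerCode_eq_succ {n : ℕ} {o : Option (Fin n)} {i : Fin n} :
    ownerCode o = i + 1 ↔ o = some i := by
  cases o <;> simp [ownerCode, Fin.ext_iff]

/-- The memory `m` holds the input and the state `s` of the auction. -/
structure Represents {n k : ℕ} (Adj : Fin n → Fin k → Prop) (r : ℕ) (s : Auction (Fin n) (Fin k))
    (m : Memory) : Prop where
  reg_zero : m.reg 0 = n
  reg_one : m.reg 1 = k
  reg_two : m.reg 2 = r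
  edge : ∀ (i : Fin n) (j : Fin k), m.arr 0 (i * k + j) ≠ 0 ↔ Adj i j
  owner : ∀ j : Fin k, m.arr 1 j = ownerCode (s.owner j)
  price : ∀ j : Fin k, m.arr 2 j = s.price j
  level : ∀ i : Fin n, m.arr 3 i = s.level i
  load : ∀ i : Fin n, m.arr 4 (i + 1) = s.load i

theorem represents_input {n k : ℕ} (Adj : Fin n → Fin k → Prop) (r : ℕ) :
    Represents Adj r ⟨fun _ => none, fun _ => 0, fun _ => 0⟩ (input r n k Adj) where
  reg_zero := rfl
  reg_one := rfl
  reg_two := rfl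
  edge i j := by
    simp only [input, true_and, ne_eq, ite_eq_right_iff, one_ne_zero, imp_false, not_not]
    refine ⟨?_, fun h => ⟨i, j, rfl, h⟩⟩
    rintro ⟨i', j', heq, h⟩
    have hk : 0 < k := j.pos
    have hi : (i : ℕ) = i' := by
      have := congrArg (· / k) heq
      simpa [Nat.mul_comm _ k, Nat.mul_add_div hk, Nat.div_eq_of_lt] using this
    have hj : (j : ℕ) = j' := by rw [hi] at heq; omega
    rwa [Fin.ext hi, Fin.ext hj]
  owner _ := by simp [input, ownerCode]
  price _ := by simp [input]
  level _ := by simp [input]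
  load _ := by simp [input, Auction.load]

namespace Represents

variable {n k : ℕ} {Adj : Fin n → Fin k → Prop} {r : ℕ} {s : Auction (Fin n) (Fin k)} {m : Memory}

/-- `Represents` does not depend on the registers `3`, `4` and `5`. -/
theorem setReg (h : Represents Adj r s m) {x : ℕ} (hx : 2 < x) (v : ℕ) :
    Represents Adj r s (m.setReg x v) where
  reg_zero := by rw [← h.reg_zero]; exact Function.update_of_ne (by omega) _ _
  reg_one := by rw [← h.reg_one]; exact Function.update_of_ne (by omega) _ _
  reg_two := by rw [← h.reg_two]; exact Function.update_of_ne (by omega) _ _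
  edge := h.edge
  owner := h.owner
  price := h.price
  level := h.level
  load := h.load

theorem restart (h : Represents Adj r s m) : Represents Adj r s (restartProg.run m) :=
  ((h.setReg (by norm_num) _).setReg (by norm_num) _).setReg (by norm_num) _

theorem raise (h : Represents Adj r s m) (i : Fin n) :
    Represents Adj r (s.raise i) (m.setArr 3 i (m.arr 3 i + 1)) where
  reg_zero := h.reg_zero
  reg_one := h.reg_one
  reg_two := h.reg_two
  edge i' j := by simpa [Memory.setArr_arr] using h.edge i' j
  owner j := by simpa [Memory.setArr_arr, Auction.raise] using h.owner j
  price j := by simpa [Memory.setArr_arr, Auction.raise] using h.price j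
  level i' := by
    simp only [Memory.setArr_arr, Auction.raise, Function.update_apply, Fin.val_inj, h.level,
      true_and]
  load i' := by
    simp only [Memory.setArr_arr, Nat.reduceEqDiff, false_and, if_false]
    exact h.load i'

theorem take (h : Represents Adj r s m) {i : Fin n} {j : Fin k} (hi : m.reg 3 = i)
    (hj : m.reg 4 = j) : Represents Adj r (s.take (n + 1) i j) (takeProg.run m) := by
  -- The load of the former owner is positive, so the truncated subtraction is exact. Without a
  -- former owner, the program changes cell `0` of array `4`, which represents nothing.
  have hload : ∀ i' : Fin n, (s.take (n + 1) i j).load i' =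
      (if (i' : ℕ) + 1 = ownerCode (s.owner j) then s.load i' - 1 else s.load i') +
        if s.level i < n + 1 ∧ i = i' then 1 else 0 := by
    intro i'
    have h1 := Auction.load_take (n + 1) s i j i'
    have h2 : s.owner j = some i' → 0 < s.load i' := fun ho =>
      Finset.card_pos.2 ⟨j, by simpa using ho⟩
    simp only [eq_comm (a := (i' : ℕ) + 1), ownerCode_eq_succ]
    by_cases ho : s.owner j = some i'
    · have := h2 ho
      simp only [ho, if_true] at h1 ⊢
      omega
    · simp only [ho, if_false] at h1 ⊢
      omega
  have hrun : takeProg.run m =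
      let m' := (m.setArr 4 (ownerCode (s.owner j)) (m.arr 4 (ownerCode (s.owner j)) - 1)).setArr 2 j
        (s.level i)
      if s.level i < n + 1 then (m'.setArr 1 j (i + 1)).setArr 4 (i + 1) (m'.arr 4 (i + 1) + 1)
      else m'.setArr 1 j 0 := by
    simp only [takeProg, Prog.run_seq, Prog.run_setArr]
    by_cases hB : s.level i < n + 1
    · rw [Prog.run_ite_of_ne_zero _ _ (by
        simp [Expr.eval, Memory.setArr_arr, Memory.setArr_reg, hi, hj, h.level, h.reg_zero]
        omega)]
      simp [Prog.run_seq, Prog.run_setArr, hB, Expr.eval, Memory.setArr_arr, Memory.setArr_reg,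
        hi, hj, h.level, h.owner]
    · rw [Prog.run_ite_of_eq_zero _ _ (by
        simp [Expr.eval, Memory.setArr_arr, Memory.setArr_reg, hi, hj, h.level, h.reg_zero]
        omega)]
      simp [Prog.run_setArr, hB, Expr.eval, Memory.setArr_arr, Memory.setArr_reg, hi, hj, h.level,
        h.owner]
  have hreg : (takeProg.run m).reg = m.reg := by
    rw [hrun]
    by_cases hB : s.level i < n + 1 <;> simp [hB, Memory.setArr_reg]
  have harr : ∀ b c, (takeProg.run m).arr b c =
      if b = 1 ∧ c = j then (if s.level i < n + 1 then (i : ℕ) + 1 else 0)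
      else if b = 2 ∧ c = j then s.level i
      else if b = 4 then (if c = ownerCode (s.owner j) then m.arr 4 c - 1 else m.arr 4 c) +
        if s.level i < n + 1 ∧ (i : ℕ) + 1 = c then 1 else 0
      else m.arr b c := by
    clear hload hreg
    intro b c
    rw [hrun]
    by_cases hB : s.level i < n + 1
    · simp only [hB, if_true, Memory.setArr_arr]
      grind
    · simp only [hB, if_false, Memory.setArr_arr]
      grind
  constructor
  · rw [hreg, h.reg_zero]
  · rw [hreg, h.reg_one]
  · rw [hreg, h.reg_two]
  · intro i' j'
    simpa [harr] using h.edge i' j'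
  · intro j'
    by_cases hj' : j' = j
    · subst hj'
      by_cases hB : s.level i < n + 1 <;> simp [harr, Auction.take, hB, ownerCode]
    · simp [harr, Auction.take, hj', Fin.val_inj, h.owner]
  · intro j'
    by_cases hj' : j' = j
    · subst hj'
      simp [harr, Auction.take]
    · simp [harr, Auction.take, hj', Fin.val_inj, h.price]
  · intro i'
    simp [harr, Auction.take, h.level]
  · intro i'
    simp [harr, hload, h.load, Fin.val_inj]

end Represents

/-- The situation in which row `i` and column `j` of the adjacency matrix are inspected next. The
rows before `i` are settled, and the columns before `j` offer nothing to `i`. The index `v` bounds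
the number of inspections to come: each return to the beginning of the matrix is due to a change
that raises the potential, which is at most `(n + 1) * (n + k)`, and it takes less than
`(n + 1) * (k + 1)` inspections to pass the whole matrix. -/
def Scanning {n k : ℕ} (Adj : Fin n → Fin k → Prop) (r : ℕ) (s : Auction (Fin n) (Fin k))
    (i j v : ℕ) (m : Memory) : Prop :=
  s.Invariant Adj r (n + 1) ∧ Represents Adj r s m ∧ m.reg 3 = i ∧ m.reg 4 = j ∧
    m.reg 5 = i * k + j ∧ i ≤ n ∧ j ≤ k ∧ (∀ x : Fin n, x < i → s.Settled Adj r (n + 1) x) ∧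
    (∀ (x : Fin n) (y : Fin k), x = i → y < j → Adj x y → s.load x < r → s.level x ≤ s.price y) ∧
    v = ((n + 1) * (n + k) - s.potential) * ((n + 1) * (k + 1)) + ((n - i) * (k + 1) + (k - j))

section

variable {n k : ℕ} {Adj : Fin n → Fin k → Prop} {r : ℕ} {s s' : Auction (Fin n) (Fin k)}
  {i j v : ℕ} {m m' : Memory}

/-- A restart leads to the first entry, from which `n * (k + 1) + k` inspections remain until the
matrix is passed. -/
theorem scanning_restart (hs : s.Invariant Adj r (n + 1)) (hm : Represents Adj r s m) :
    Scanning Adj r s 0 0 (((n + 1) * (n + k) - s.potential) * ((n + 1) * (k + 1)) +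
      (n * (k + 1) + k)) (restartProg.run m) := by
  refine ⟨hs, hm.restart, ?_, ?_, ?_, Nat.zero_le _, Nat.zero_le _, ?_, ?_, rfl⟩
  · rfl
  · rfl
  · simp [restartProg, Prog.run, Memory.setReg, Expr.eval]
  · intro x hx
    exact absurd hx (Nat.not_lt_zero _)
  · intro x y _ hy
    exact absurd hy (Nat.not_lt_zero _)

theorem Scanning.exists_restart (h : Scanning Adj r s i j v m)
    (hs' : s'.Invariant Adj r (n + 1)) (hm' : Represents Adj r s' m')
    (hpot : s.potential < s'.potential) :
    ∃ v' < v, Scanning Adj r s' 0 0 v' (restartProg.run m') := by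
  refine ⟨_, ?_, scanning_restart hs' hm'⟩
  obtain ⟨-, -, -, -, -, -, -, -, -, rfl⟩ := h
  have hle := hs'.potential_le
  rw [Fintype.card_fin, Fintype.card_fin] at hle
  have h1 : (n + 1) * (n + k) - s'.potential + 1 ≤ (n + 1) * (n + k) - s.potential := by omega
  have h2 := Nat.mul_le_mul_right ((n + 1) * (k + 1)) h1
  have h3 : (n + 1) * (k + 1) = n * (k + 1) + k + 1 := by ring
  rw [add_mul, one_mul] at h2
  omega

/-- Each inspection preserves the situation, for some state of the auction, and lowers the index. -/
theorem Scanning.step (h : Scanning Adj r s i j v m) (hi : i < n) :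
    ∃ v' < v, ∃ s' i' j', Scanning Adj r s' i' j' v' (auctionBody.run m) := by
  have h' := h
  obtain ⟨hs, hm, hr3, hr4, hr5, -, hjk, hset, hrow, hv⟩ := h'
  set x : Fin n := ⟨i, hi⟩ with hx
  have hr3' : m.reg 3 = x := hr3
  have hlevel : m.arr 3 i = s.level x := hm.level x
  have hload : m.arr 4 (i + 1) = s.load x := hm.load x
  have hdef : deficientExpr.eval m ≠ 0 ↔ s.load x < r := by
    simp only [deficientExpr, Expr.eval, hm.reg_two, hr3, hload]
    omega
  by_cases hj : j < k
  · have hbranch : (Expr.sub (.reg 1) (.reg 4)).eval m ≠ 0 := by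
      simp only [Expr.eval, hm.reg_one, hr4]
      omega
    set y : Fin k := ⟨j, hj⟩ with hy
    have hr4' : m.reg 4 = y := hr4
    have hprice : m.arr 2 j = s.price y := hm.price y
    have hedge : (Expr.arr 0 (.reg 5)).eval m ≠ 0 ↔ Adj x y := by
      simp only [Expr.eval, hr5]
      exact hm.edge x y
    have hcmp : (Expr.sub (.arr 3 (.reg 3)) (.arr 2 (.reg 4))).eval m ≠ 0 ↔
        s.price y < s.level x := by
      simp only [Expr.eval, hr3, hr4, hlevel, hprice]
      omega
    by_cases hc : Adj x y ∧ s.load x < r ∧ s.price y < s.level x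
    · have hrun : auctionBody.run m = restartProg.run (takeProg.run m) := by
        rw [auctionBody, Prog.run_ite_of_ne_zero _ _ hbranch,
          Prog.run_ite_of_ne_zero _ _ (by
          rwa [Expr.eval_conj_ne_zero, Expr.eval_conj_ne_zero, hedge, hdef, hcmp]), Prog.run_seq]
      obtain ⟨v', hv', h'⟩ := h.exists_restart (hs.take hc.1 hc.2.1 hc.2.2) (hm.take hr3' hr4')
        (Auction.potential_take _ hc.2.2)
      exact ⟨v', hv', _, _, _, hrun ▸ h'⟩
    · have hrun : auctionBody.run m = (m.setReg 4 (j + 1)).setReg 5 (i * k + j + 1) := by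
        rw [auctionBody, Prog.run_ite_of_ne_zero _ _ hbranch,
          Prog.run_ite_of_eq_zero _ _ (not_not.1 <| by
          rwa [← ne_eq, Expr.eval_conj_ne_zero, Expr.eval_conj_ne_zero, hedge, hdef, hcmp])]
        simp [Prog.run, Expr.eval, hr4, hr5, Memory.setReg]
      rw [hrun]
      refine ⟨v - 1, ?_, s, i, j + 1, hs, (hm.setReg (by norm_num) _).setReg (by norm_num) _,
        ?_, ?_, ?_, hi.le, hj, hset, ?_, ?_⟩
      · omega
      · simpa [Memory.setReg] using hr3
      · simp [Memory.setReg]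
      · simp [Memory.setReg, add_assoc]
      · intro x' y' hx' hy' hadj hl
        obtain rfl : x' = x := Fin.ext hx'
        rcases Nat.lt_succ_iff_lt_or_eq.1 hy' with hlt | heq
        · exact hrow x y' rfl hlt hadj hl
        · obtain rfl : y' = y := Fin.ext heq
          by_contra hlt
          exact hc ⟨hadj, hl, not_le.1 hlt⟩
      · omega
  · have hbranch : ¬ (Expr.sub (.reg 1) (.reg 4)).eval m ≠ 0 := by
      simp only [Expr.eval, hm.reg_one, hr4]
      omega
    obtain rfl : j = k := by omega
    have htop : (Expr.sub (.add (.reg 0) (.const 1)) (.arr 3 (.reg 3))).eval m ≠ 0 ↔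
        s.level x < n + 1 := by
      simp only [Expr.eval, hm.reg_zero, hr3, hlevel]
      omega
    by_cases hc : s.load x < r ∧ s.level x < n + 1
    · have hrun : auctionBody.run m = restartProg.run (m.setArr 3 x (m.arr 3 x + 1)) := by
        rw [auctionBody, Prog.run_ite_of_eq_zero _ _ (not_not.1 hbranch),
          Prog.run_ite_of_ne_zero _ _ (by
          rwa [Expr.eval_conj_ne_zero, hdef, htop])]
        simp only [Prog.run, Expr.eval, hr3']
      obtain ⟨v', hv', h'⟩ := h.exists_restart
        (hs.raise (by simp) hc.1 hc.2 fun y hy => hrow x y rfl y.2 hy hc.1) (hm.raise x)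
        (by rw [Auction.potential_raise]; omega)
      exact ⟨v', hv', _, _, _, hrun ▸ h'⟩
    · have hrun : auctionBody.run m = (m.setReg 3 (i + 1)).setReg 4 0 := by
        rw [auctionBody, Prog.run_ite_of_eq_zero _ _ (not_not.1 hbranch),
          Prog.run_ite_of_eq_zero _ _ (not_not.1 <| by
          rwa [← ne_eq, Expr.eval_conj_ne_zero, hdef, htop])]
        simp [Prog.run, Expr.eval, hr3, Memory.setReg]
      rw [hrun]
      have hni : (n - i) * (j + 1) = (n - (i + 1)) * (j + 1) + (j + 1) := by
        rw [show n - i = n - (i + 1) + 1 by omega, add_mul, one_mul]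
      refine ⟨v - 1, ?_, s, i + 1, 0, hs, (hm.setReg (by norm_num) _).setReg (by norm_num) _,
        ?_, ?_, ?_, hi, Nat.zero_le _, ?_, ?_, ?_⟩
      · omega
      · simp [Memory.setReg]
      · simp [Memory.setReg]
      · simp [Memory.setReg, hr5, add_mul]
      · intro x' hx'
        rcases Nat.lt_succ_iff_lt_or_eq.1 hx' with hlt | heq
        · exact hset x' hlt
        · obtain rfl : x' = x := Fin.ext heq
          intro hl
          have := hs.level_le x
          exact ⟨by omega, fun y hy => hrow x y rfl y.2 hy hl⟩
      · intro x' y' _ hy'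
        exact absurd hy' (Nat.not_lt_zero _)
      · omega

theorem Represents.isOutput (h : Represents Adj r s m) (hs : s.Invariant Adj r (n + 1))
    (hset : ∀ x, s.Settled Adj r (n + 1) x) : IsOutput m (s.matching r) where
  leaf S hS j hj := by
    obtain ⟨-, h2⟩ := Auction.mem_matching.1 hS
    rw [h.owner]
    exact ownerCode_eq_succ.2 (by simpa [h2] using hj)
  not_leaf j hj := by
    rw [h.owner]
    cases ho : s.owner j with
    | none => rfl
    | some x =>
      by_cases hload : s.load x = r
      · exact absurd (by simpa using ho)
          (hj (x, ({y | s.owner y = some x} : Finset _)) (Auction.mem_matching.2 ⟨hload, rfl⟩))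
      · have := hs.owner_eq_none (hset x) hload (hs.owner_adj ho)
        simp [this] at ho

end

theorem findsMaximum_auctionProg : ∃ p : Polynomial ℕ,
    FindsMaximumEnvyFreeStarMatching auctionProg (fun N => p.eval N) := by
  refine ⟨((.X + 1) ^ 3 * .X + (.X + 1) ^ 2) *
    .C ((Expr.sub (.reg 0) (.reg 3)).cost + 1 + auctionBody.maxCost), ?_⟩
  intro r _ n k Adj
  have hfree : auctionBody.LoopFree := by
    simp [auctionBody, takeProg, restartProg, Prog.LoopFree]
  have hstart : Scanning Adj r ⟨fun _ => none, fun _ => 0, fun _ => 0⟩ 0 0 _ (input r n k Adj) :=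
    ⟨Auction.Invariant.initial Adj r (Nat.succ_pos n), represents_input Adj r, rfl, rfl,
      by simp [input], Nat.zero_le _, Nat.zero_le _, fun x hx => absurd hx (Nat.not_lt_zero _),
      fun x y _ hy => absurd hy (Nat.not_lt_zero _), rfl⟩
  obtain ⟨t, m, hexec, ht, ⟨v, s, i, j, hs, hm, hr3, -, -, hi, -, hset, -, -⟩, hend⟩ :=
    hfree.exec_loop (.sub (.reg 0) (.reg 3)) (fun v m => ∃ s i j, Scanning Adj r s i j v m)
      (by
        rintro v m ⟨s, i, j, h⟩ he
        have h' := h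
        obtain ⟨-, hm, hr3, -⟩ := h'
        refine h.step ?_
        simp only [Expr.eval, hm.reg_zero, hr3] at he
        omega) _ _ ⟨_, _, _, hstart⟩
  have hset' : ∀ x, s.Settled Adj r (n + 1) x := by
    simp only [Expr.eval, hm.reg_zero, hr3] at hend
    exact fun x => hset x (by omega)
  refine ⟨t, m, s.matching r, hexec, ht.trans ?_, hm.isOutput hs hset', hs.isMaximum hset'⟩
  simp only [Polynomial.eval_mul, Polynomial.eval_add, Polynomial.eval_pow, Polynomial.eval_X,
    Polynomial.eval_one, Polynomial.eval_C]
  refine Nat.mul_le_mul_right _ ?_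
  have h1 : (n + 1) * (k + 1) ≤ (n + k + 1) ^ 2 := by nlinarith
  have h2 : (n + 1) * (n + k) ≤ (n + k + 1) * (n + k) := Nat.mul_le_mul_right _ (by omega)
  calc _ ≤ (n + 1) * (n + k) * ((n + 1) * (k + 1)) + (n * (k + 1) + k) + 1 := by
        simp only [Nat.sub_zero]
        gcongr
        exact Nat.sub_le _ _
    _ = (n + 1) * (n + k) * ((n + 1) * (k + 1)) + (n + 1) * (k + 1) := by ring
    _ ≤ (n + k + 1) * (n + k) * (n + k + 1) ^ 2 + (n + k + 1) ^ 2 := by gcongr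
    _ = _ := by ring

end StarMatching

theorem theorem6 :
    (∃ (prog : RAM.Prog) (p : Polynomial ℕ),
      StarMatching.FindsMaximumEnvyFreeStarMatching prog (fun N => p.eval N)) ∧
    (∀ (X : Type*) (Y : Type*) [Finite X] [Finite Y] (Adj : X → Y → Prop) (r : ℕ),
      r * Nat.card X ≤ (StarMatching.neighborhood Adj Set.univ).ncard → 1 ≤ r * Nat.card X →
      ∃ W : Finset (X × Finset Y),
        W.Nonempty ∧ StarMatching.IsEnvyFreeStarMatching Adj r W) :=
  ⟨⟨StarMatching.auctionProg, StarMatching.findsMaximum_auctionProg⟩,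
    fun _ _ _ _ Adj r => StarMatching.exists_nonempty_envyFree Adj r⟩
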